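/- **Setting.** Let $G=(V,E)$ be any finite undirected graph whose vertices are agents; put $\mathcal N_i=\{i\}\cup\{j:(i,j)\in E\}$, $N_i=|\mathcal N_i|$, $N_{\max}=\max_i N_i$. Let $w_{ij}\ge 0$ ($j\in\mathcal N_i$) satisfy $\sum_{j\in\mathcal N_i}w_{ij}=1$ for every $i$, let $(\beta^{(j)}_n)_{n\ge 0}$ be positive learning-rate parameters for each agent $j$, let $T\ge 2$ be the horizon and $d$ the dimension. The losses $\ell_t:\mathbb R^d\to\mathbb R$ are linear and $1$-Lipschitz, so their gradients satisfy $\|g_t\|_2\le 1$. **Tree-based aggregation** with distribution $\mathcal D$ and horizon $T$. Let $K=\lceil\log_2T\rceil$ and consider the complete binary tree with $2^K$ leaves; the $n$-th summand received is stored at the $n$-th leaf. Each node carries an independent noise vector of law $\mathcal D$. After $n$ summands the output is the sum, over the minimal set of $q\le K$ nodes whose subtrees partition the first $n$ leaves (given by the binary expansion of $n$), of the subtree sum plus the noise of the node, plus $K-q$ fresh independent noise vectors of law $\mathcal D$. **Algorithm.** Agent $j$ stores sanitized gradient sums $\tilde\Gamma^{(j)}\in\mathbb R^{\mathcal N_j\times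 d}$ and sanitized inner-product sums $\tilde s^{(j,\xi)}_i$ for $i\in\mathcal N_j$ and $\xi\in\Xi_j=\{1/N_j,\dots,1\}$, all initially $0$. If $n$ denotes the number of past rounds whose active agent lies in $\mathcal N_j$, then, at the current round $t$, $$X_t^{(j,\xi)}=\operatorname*{argmin}_X\ \tfrac{N_j}{\beta^{(j)}_n}\sqrt{1+\xi(N_j-1)}\,\langle\tilde\Gamma^{(j)},X\rangle+\tfrac12\|X\|_{A_j}^2,$$ over the matrices $X\in\mathbb R^{\mathcal N_j\times d}$ with rows in the Euclidean unit ball and $\sigma^2(X)=\frac1{N_j-1}\sum_{i}\|X_{i:}-\frac1{N_j}\sum_kX_{k:}\|_2^2\le\xi$ ($\sigma^2=0$ if $N_j=1$), where $A_j=(1+N_j)I-\mathbf 1\mathbf 1^\top$ and $\|X\|_{A_j}^2=\operatorname{tr}(X^\top A_jX)$; $$p_t^{(j,\xi)}\propto\exp\Big(-\tfrac{\sqrt{\ln N_j}}{\beta^{(j)}_n}\sum_{i\in\mathcal N_j}\tilde s^{(j,\xi)}_i\Big),\qquad Y_t^{(j)}=\sum_{\xi\in\Xi_j}p_t^{(j,\xi)}X_t^{(j,\xi)}.$$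 At round $t=1,\dots,T$ the active agent $a=i_t$ fetches $p_t^{(j,\cdot)}$ and $([X_t^{(j,\xi)}]_{a:})_{\xi\in\Xi_j}$ from each $j\in\mathcal N_a$, predicts $x_t=\sum_{j\in\mathcal N_a}w_{aj}[Y_t^{(j)}]_{a:}$, and observes $g_t=\nabla\ell_t(x_t)$. Using one instance of tree-based aggregation with distribution $\mathcal D_d$ (on $\mathbb R^d$) per agent, it computes a sanitized version $\tilde\gamma_t^{(a)}$ of $\sum_{s\le t}g_s\mathbf 1\{i_s=a\}$. Using one instance with distribution $\mathcal D_1$ (on $\mathbb R$) per triple $(a,j,\xi)$, with $j\in\mathcal N_a$ and $\xi\in\Xi_j$, it computes a sanitized version $\tilde s^{(j,\xi)}_{t,a}$ of $\sum_{s\le t}w_{aj}\langle[X_s^{(j,\xi)}]_{a:},g_s\rangle\mathbf 1\{i_s=a\}$. It sends $w_{aj}\tilde\gamma_t^{(a)}$ and $(\tilde s_{t,a}^{(j,\xi)})_{\xi\in\Xi_j}$ to each $j\in\mathcal N_a$, and $j$ sets $[\tilde\Gamma^{(j)}]_{a:}=w_{aj}\tilde\gamma_t^{(a)}$ and $\tilde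 s^{(j,\xi)}_a=\tilde s^{(j,\xi)}_{t,a}$. All noise vectors of all instances are independent. **Messages.** $m^{(i)}_t=(m_t^{(i\to j)})_{j\in\mathcal N_i}$, where $m_t^{(i\to j)}$ equals $\big(p_t^{(i,\cdot)},([X_t^{(i,\xi)}]_{j:})_{\xi\in\Xi_i}\big)$ if $i\ne i_t=j$; equals $\big(w_{ij}\tilde\gamma_t^{(i)},(\tilde s_{t,i}^{(j,\xi)})_{\xi\in\Xi_j}\big)$ if $i=i_t$; and is empty otherwise. **Theorem.** Let $\varepsilon>0$ and $\varepsilon'=\varepsilon/(6N_{\max}^2)$. Let $\mathcal D_d$ be the $d$-dimensional Laplace distribution with parameter $\sqrt d\,\ln T/\varepsilon'$ and $\mathcal D_1$ the one-dimensional Laplace distribution with parameter $\ln T/\varepsilon'$ (the $d$-dimensional Laplace distribution with parameter $b$ has independent coordinates of density $\frac1{2b}e^{-|x|/b}$). Then the algorithm is loss-level $\varepsilon$-differentially private on linear losses: for all activations $i_1,\dots,i_T$, all sequences $(\ell_t)_{t\le T}$, $(\ell'_t)_{t\le T}$ of linear $1$-Lipschitz losses differing in at most one entry, every agent $i$ and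 every measurable set $\mathcal M$ of sequences of batches of messages, $$\mathbb P\big((m^{(i)}_1,\dots,m^{(i)}_T)\in\mathcal M\mid i_1,\ell_1,\dots,i_T,\ell_T\big)\le e^{\varepsilon}\,\mathbb P\big((m^{(i)}_1,\dots,m^{(i)}_T)\in\mathcal M\mid i_1,\ell'_1,\dots,i_T,\ell'_T\big).$$ -/

import Mathlib

open scoped BigOperators

namespace MTPriv

/-! ### Laplace distributions -/

/-- The centred Laplace distribution on `ℝ` with (scale) parameter `b > 0`, of density
`x ↦ exp (-|x| / b) / (2 b)`. -/
noncomputable def laplace (b : ℝ) : MeasureTheory.Measure ℝ :=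
  MeasureTheory.volume.withDensity fun x => ENNReal.ofReal (Real.exp (-|x| / b) / (2 * b))

/-- The `d`-dimensional Laplace distribution with parameter `b`: independent coordinates, each of
law `laplace b`. -/
noncomputable def laplaceVec (d : ℕ) (b : ℝ) : MeasureTheory.Measure (EuclideanSpace ℝ (Fin d)) :=
  (MeasureTheory.Measure.pi fun _ : Fin d => laplace b).map (MeasurableEquiv.toLp 2 (Fin d → ℝ))

/-! ### Tree-based aggregation -/

/-- Number of levels above the leaves of the binary tree for `T` summands, `⌈log₂ T⌉`. -/
def depth (T : ℕ) : ℕ := Nat.clog 2 T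

/-- Nodes of the complete binary tree with `2 ^ depth T` leaves `0, 1, 2, …`: the node `⟨h, b⟩`
of height `h` is the root of the subtree with leaves `b 2^h, …, (b + 1) 2^h - 1`. -/
abbrev Node (T : ℕ) : Type := (h : Fin (depth T + 1)) × Fin (2 ^ (depth T - (h : ℕ)))

/-- Indices of the noise vectors used by one instance of tree-based aggregation with horizon `T`:
one for each node of the tree, and, for each of the `T` releases, `depth T` further ones from
which the noise of that release is completed. -/
abbrev TreeIdx (T : ℕ) : Type := Node T ⊕ (Fin T × Fin (depth T))

/-- The sum of the entries of `l` stored at the leaves below the node `v`. -/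
def nodeSum {T : ℕ} {α : Type*} [AddCommMonoid α] (l : List α) (v : Node T) : α :=
  ∑ m ∈ Finset.Ico ((v.2 : ℕ) * 2 ^ (v.1 : ℕ)) (((v.2 : ℕ) + 1) * 2 ^ (v.1 : ℕ)), l.getD m 0

/-- The minimal set of nodes whose subtrees partition the first `n` leaves: one node of height `h`
for each binary digit `1` of `n` at position `h`. -/
def prefixNodes (T n : ℕ) : Finset (Node T) :=
  Finset.univ.filter fun v => n.testBit (v.1 : ℕ) = true ∧ (v.2 : ℕ) + 1 = n / 2 ^ (v.1 : ℕ)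

/-- Indices of the noise vectors completing the release of the sum of the first `n` summands, so
that it contains `depth T` independent noise vectors in total. -/
def completion (T n : ℕ) : Finset (Fin T × Fin (depth T)) :=
  Finset.univ.filter fun q => (q.1 : ℕ) + 1 = n ∧ (q.2 : ℕ) < depth T - (prefixNodes T n).card

/-- Output of tree-based aggregation once the summands `l` have been received, for the noise
vectors `z`: the sum of the noisy node values over the partition of the leaves, plus the
completing noise. -/
def treeAgg {T : ℕ} {α : Type*} [AddCommMonoid α] (z : TreeIdx T → α) (l : List α) : α :=
  ∑ v ∈ prefixNodes T l.length, (nodeSum l v + z (Sum.inl v)) +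
    ∑ q ∈ completion T l.length, z (Sum.inr q)

/-! ### The base algorithm (private multitask FTRL on a clique) -/

section Clique

variable {ι : Type*} [Fintype ι] [DecidableEq ι] {d : ℕ}

/-- The matrix `A = (1 + N) I - 1 1ᵀ`, `N` being the size of the clique. -/
def cliqueMatrix (ι : Type*) [Fintype ι] [DecidableEq ι] : Matrix ι ι ℝ :=
  (1 + (Fintype.card ι : ℝ)) • (1 : Matrix ι ι ℝ) - Matrix.of fun _ _ => 1

/-- `‖X‖_A² = tr (Xᵀ A X)`, where `X i` is the `i`-th row of `X`. -/
noncomputable def mahalanobisSq (X : ι → EuclideanSpace ℝ (Fin d)) : ℝ :=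
  ∑ i, ∑ k, cliqueMatrix ι i k * inner ℝ (X i) (X k)

/-- The variance `σ²(X) = (N - 1)⁻¹ ∑ i, ‖X i - N⁻¹ ∑ k, X k‖²` of the rows of `X` (it is `0` for a
clique of size one). -/
noncomputable def rowVariance (X : ι → EuclideanSpace ℝ (Fin d)) : ℝ :=
  ((Fintype.card ι : ℝ) - 1)⁻¹ * ∑ i, ‖X i - (Fintype.card ι : ℝ)⁻¹ • ∑ k, X k‖ ^ 2

/-- Matrices with rows in the unit ball and row variance at most `ξ`. -/
def feasible (ι : Type*) [Fintype ι] (d : ℕ) (ξ : ℝ) : Set (ι → EuclideanSpace ℝ (Fin d)) :=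
  {X | (∀ i, ‖X i‖ ≤ 1) ∧ rowVariance X ≤ ξ}

/-- The objective `η ⟨Γ, X⟩ + ‖X‖_A² / 2`. -/
noncomputable def ftrlObjective (η : ℝ) (Γ X : ι → EuclideanSpace ℝ (Fin d)) : ℝ :=
  η * ∑ i, inner ℝ (Γ i) (X i) + mahalanobisSq X / 2

/-- The minimizer of the objective over the feasible set (the objective is strictly convex and the
feasible set is nonempty, convex and compact when `0 ≤ ξ`, so it exists and is unique). -/
noncomputable def ftrlArgmin (η ξ : ℝ) (Γ : ι → EuclideanSpace ℝ (Fin d)) :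
    ι → EuclideanSpace ℝ (Fin d) :=
  Classical.epsilon fun X =>
    X ∈ feasible ι d ξ ∧ IsMinOn (ftrlObjective η Γ) (feasible ι d ξ) X

/-- The experts are indexed by `Ξ = {1/N, 2/N, …, 1}`; the index `k` stands for `(k + 1) / N`. -/
noncomputable def expertLevel (ι : Type*) [Fintype ι] (k : Fin (Fintype.card ι)) : ℝ :=
  ((k : ℝ) + 1) / (Fintype.card ι : ℝ)

/-- Memory of an instance of the base algorithm: the number of completed (local) rounds, the
sanitized gradient sums `Γ` and the sanitized inner-product sums `s`. -/
structure CliqueState (ι : Type*) [Fintype ι] (d : ℕ) where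
  rounds : ℕ
  Γ : ι → EuclideanSpace ℝ (Fin d)
  s : ι → Fin (Fintype.card ι) → ℝ

/-- The prediction `X^{(ξ)}` of expert `k` in the next round; `β n` is the learning-rate parameter
after `n` completed rounds. -/
noncomputable def CliqueState.expert (β : ℕ → ℝ) (S : CliqueState ι d)
    (k : Fin (Fintype.card ι)) : ι → EuclideanSpace ℝ (Fin d) :=
  ftrlArgmin
    ((Fintype.card ι : ℝ) / β S.rounds *
      Real.sqrt (1 + expertLevel ι k * ((Fintype.card ι : ℝ) - 1)))
    (expertLevel ι k) S.Γ

/-- The unnormalized exponential weight of expert `k`. -/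
noncomputable def CliqueState.weight (β : ℕ → ℝ) (S : CliqueState ι d)
    (k : Fin (Fintype.card ι)) : ℝ :=
  Real.exp (-(Real.sqrt (Real.log (Fintype.card ι : ℝ)) / β S.rounds) * ∑ i, S.s i k)

/-- The probability of expert `k` in the next round. -/
noncomputable def CliqueState.prob (β : ℕ → ℝ) (S : CliqueState ι d)
    (k : Fin (Fintype.card ι)) : ℝ :=
  S.weight β k / ∑ k', S.weight β k'

/-- The averaged prediction `Y = ∑ ξ, p^{(ξ)} X^{(ξ)}`. -/
noncomputable def CliqueState.predict (β : ℕ → ℝ) (S : CliqueState ι d) :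
    ι → EuclideanSpace ℝ (Fin d) :=
  fun i => ∑ k, S.prob β k • S.expert β k i

end Clique

/-! ### The multi-agent algorithm -/

section Network

theorem nb_symm {V : Type*} (G : SimpleGraph V) {i j : V} (h : j = i ∨ G.Adj i j) :
    i = j ∨ G.Adj j i :=
  h.imp Eq.symm fun h => G.adj_symm h

variable {V : Type*} [Fintype V] [DecidableEq V] (G : SimpleGraph V) [DecidableRel G.Adj]

/-- The closed neighbourhood of agent `i`. -/
abbrev Nb (i : V) : Type _ := {j : V // j = i ∨ G.Adj i j}

/-- The size `N_i` of the closed neighbourhood of `i`. -/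
abbrev nbCard (i : V) : ℕ := Fintype.card (Nb G i)

/-- `N_max`, the largest size of a closed neighbourhood. -/
def nMax : ℕ := Finset.univ.sup fun i => nbCard G i

/-- Indices of the instances of tree-based aggregation sanitizing the inner-product sums: an agent
`j`, a neighbour `i` of `j` (whose gradients are used) and an expert of `j`. -/
abbrev InnerIdx : Type _ := (j : V) × (Nb G j × Fin (nbCard G j))

/-- All noise variables used in `T` rounds: for each agent a tree with noise in `ℝ^d` for its
gradient sum, and for each element of `InnerIdx` a tree with real noise. -/
abbrev Noise (d T : ℕ) : Type _ :=
  (V × TreeIdx T → EuclideanSpace ℝ (Fin d)) × (InnerIdx G × TreeIdx T → ℝ)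

/-- All noise variables are independent, of law `Dd` for gradient sums and `D1` for inner-product
sums. -/
noncomputable def noiseLaw {d : ℕ} (T : ℕ)
    (Dd : MeasureTheory.Measure (EuclideanSpace ℝ (Fin d))) (D1 : MeasureTheory.Measure ℝ) :
    MeasureTheory.Measure (Noise G d T) :=
  (MeasureTheory.Measure.pi fun _ : V × TreeIdx T => Dd).prod
    (MeasureTheory.Measure.pi fun _ : InnerIdx G × TreeIdx T => D1)

/-- Global state: the gradients observed so far by each agent; the list of summands of each
inner-product sum; and the memory of the base algorithm of each agent. -/
structure State (d : ℕ) where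
  grads : V → List (EuclideanSpace ℝ (Fin d))
  inners : (j : V) → Nb G j → Fin (nbCard G j) → List ℝ
  mem : (j : V) → CliqueState (Nb G j) d

/-- Nothing has been observed and all sanitized sums are set to zero. -/
def initState (d : ℕ) : State G d where
  grads := fun _ => []
  inners := fun _ _ _ => []
  mem := fun _ => ⟨0, fun _ => 0, fun _ _ => 0⟩

variable {G} {d T : ℕ} (w : V → V → ℝ) (β : V → ℕ → ℝ)

/-- The prediction `∑ j ∈ N_a, w_{aj} [Y^{(j)}]_a` of the active agent `a`. -/
noncomputable def State.predict (S : State G d) (a : V) : EuclideanSpace ℝ (Fin d) :=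
  ∑ j : Nb G a, w a j • (S.mem j).predict (β j) ⟨a, nb_symm G j.2⟩

/-- One round, with active agent `a` and loss `ℓ`: agent `a` predicts, observes the gradient of
`ℓ` at its prediction, and computes the new sanitized sums; every agent `j` in the closed
neighbourhood of `a` stores them in its memory. -/
noncomputable def State.step (z : Noise G d T) (a : V) (ℓ : EuclideanSpace ℝ (Fin d) → ℝ)
    (S : State G d) : State G d :=
  let g := gradient ℓ (S.predict w β a)
  let grads' : V → List (EuclideanSpace ℝ (Fin d)) :=
    fun i => if i = a then S.grads i ++ [g] else S.grads i
  let inners' : (j : V) → Nb G j → Fin (nbCard G j) → List ℝ := fun j i k =>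
    if i.1 = a then S.inners j i k ++ [w a j * inner ℝ ((S.mem j).expert (β j) k i) g]
    else S.inners j i k
  { grads := grads'
    inners := inners'
    mem := fun j =>
      if a = j ∨ G.Adj j a then
        { rounds := (S.mem j).rounds + 1
          Γ := fun i =>
            if i.1 = a then w a j • treeAgg (fun v => z.1 (a, v)) (grads' a) else (S.mem j).Γ i
          s := fun i k =>
            if i.1 = a then treeAgg (fun v => z.2 (⟨j, i, k⟩, v)) (inners' j i k)
            else (S.mem j).s i k }
      else S.mem j }

/-- The state after `t` rounds. -/
noncomputable def stateAt (acts : Fin T → V) (ℓ : Fin T → EuclideanSpace ℝ (Fin d) → ℝ)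
    (z : Noise G d T) : (t : ℕ) → t ≤ T → State G d
  | 0, _ => initState G d
  | t + 1, h =>
      (stateAt acts ℓ z t (Nat.le_of_succ_le h)).step w β z (acts ⟨t, h⟩) (ℓ ⟨t, h⟩)

variable (G d) in
/-- Messages from agent `i` to agent `j`: either (fetch step) the expert probabilities of `i` and
the rows concerning `j` of the experts of `i`; or (send step) the weighted sanitized gradient sum
of `i` and the sanitized inner-product sums for the experts of `j`; or nothing. -/
abbrev Message (i j : V) : Type :=
  ((Fin (nbCard G i) → ℝ) × (Fin (nbCard G i) → EuclideanSpace ℝ (Fin d))) ⊕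
    ((EuclideanSpace ℝ (Fin d) × (Fin (nbCard G j) → ℝ)) ⊕ Unit)

variable (G d) in
/-- Batches of messages from agent `i`, one message for each `j` in its closed neighbourhood. -/
abbrev Batch (i : V) : Type _ := (j : Nb G i) → Message G d i j

/-- The batch of messages of agent `i` in round `t`. In the send step, agent `j` has stored in row
`i` of its memory exactly what it received in the round, namely `w_{ij}` times the sanitized
gradient sum of `i`, and the sanitized inner-product sums. -/
noncomputable def batch (acts : Fin T → V) (ℓ : Fin T → EuclideanSpace ℝ (Fin d) → ℝ)
    (z : Noise G d T) (i : V) (t : Fin T) : Batch G d i := fun j =>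
  let before := stateAt w β acts ℓ z t t.2.le
  let after := stateAt w β acts ℓ z (t + 1) t.2
  if acts t = i then
    Sum.inr (Sum.inl ((after.mem j).Γ ⟨i, nb_symm G j.2⟩, (after.mem j).s ⟨i, nb_symm G j.2⟩))
  else if acts t = j then
    Sum.inl ((before.mem i).prob (β i), fun k => (before.mem i).expert (β i) k j)
  else Sum.inr (Sum.inr ())

end Network

/-! ### Loss-level differential privacy -/

/-- Loss-level `ε`-differential privacy over `T` rounds, for losses in the class `L`, of a
randomized multi-agent algorithm: `msg acts ℓ ω i t` is the batch of messages sent by agent `i` in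
round `t` when the activations are `acts`, the losses are `ℓ` and the internal randomness is `ω`,
which has law `P`. -/
def LossLevelDP {V Loss Ω : Type*} {B : V → Type*} [MeasurableSpace Ω]
    [∀ i, MeasurableSpace (B i)] {T : ℕ} (P : MeasureTheory.Measure Ω) (L : Set Loss)
    (msg : (Fin T → V) → (Fin T → Loss) → Ω → (i : V) → Fin T → B i) (ε : ℝ) : Prop :=
  ∀ (acts : Fin T → V) (ℓ ℓ' : Fin T → Loss), (∀ t, ℓ t ∈ L) → (∀ t, ℓ' t ∈ L) →
    (∀ s t, ℓ s ≠ ℓ' s → ℓ t ≠ ℓ' t → s = t) →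
    ∀ (i : V) (M : Set (Fin T → B i)), MeasurableSet M →
      P {ω | msg acts ℓ ω i ∈ M} ≤ ENNReal.ofReal (Real.exp ε) * P {ω | msg acts ℓ' ω i ∈ M}

/-- Linear `1`-Lipschitz losses on `ℝ^d`. -/
def linearLosses (d : ℕ) : Set (EuclideanSpace ℝ (Fin d) → ℝ) :=
  {ℓ | IsLinearMap ℝ ℓ ∧ LipschitzWith 1 ℓ}

end MTPriv

namespace MTPriv

open MeasureTheory

/-! ### Translates of product and Laplace measures -/

/-! The proof couples the executions on the two loss sequences by translating the noise. Gradients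
of linear losses do not depend on the predictions, so replacing the loss of round `s` alters one
summand, at one leaf `m`, of the gradient tree of the active agent. Adding the change to the noise
of every usable node above `m` leaves all releases of that tree intact (`DiffersAt.treeAgg_eq`). The
memories then agree in both executions, so the experts agree, and each inner-product tree also
changes at leaf `m` only, by a multiple of an inner product with an expert row. That row depends on
the gradient noise alone. The coupling is therefore a shear `(z₁, z₂) ↦ (z₁ + c, z₂ + δ z₁)` under
which all messages coincide (`stateAt_coupling`, `batch_coupling`), and `prod_shear_le` bounds its
effect on the noise law. Measurability of `δ` comes from continuity of the FTRL minimizer, by strong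
convexity.

The cost is the number `C` of translated nodes per tree times the total size of the changes, over
the Laplace scale: at most `2` for the gradient and `2 N_max` for the inner products. The constant 6
needs care only when `N_max = 1`. There either `m ≠ 0`, and one level of the tree drops out
(`card_touched_le_of_pos`), or `m = 0`, and the experts still predict zero (`innerChange_eq_zero`).
-/

theorem pi_le_of_le_smul {ι : Type*} [Fintype ι] {α : ι → Type*} [∀ i, MeasurableSpace (α i)]
    (μ ν : ∀ i, Measure (α i)) [∀ i, SigmaFinite (μ i)] (C : ι → ENNReal)
    (hC0 : ∀ i, C i ≠ 0) (hC : ∀ i, C i ≠ ⊤) (h : ∀ i, μ i ≤ C i • ν i) :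
    Measure.pi μ ≤ (∏ i, C i) • Measure.pi ν := by
  have hP0 : ∏ i, C i ≠ 0 := Finset.prod_ne_zero_iff.2 fun i _ => hC0 i
  -- The product outer measure is the largest one bounded on boxes by the product of the sides, so a
  -- bound on boxes suffices and no σ-finiteness of the `ν i` is needed.
  have hP : ∏ i, C i ≠ ⊤ := ENNReal.prod_ne_top fun i _ => hC i
  have key : ((∏ i, C i)⁻¹ • Measure.pi μ).toOuterMeasure ≤
      OuterMeasure.pi fun i => (ν i).toOuterMeasure := by
    rw [OuterMeasure.le_pi]
    intro s _
    have h1 : Measure.pi μ (Set.univ.pi s) ≤ (∏ i, C i) * ∏ i, ν i (s i) := by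
      rw [Measure.pi_pi, ← Finset.prod_mul_distrib]
      exact Finset.prod_le_prod' fun i _ => h i (s i)
    calc (∏ i, C i)⁻¹ * Measure.pi μ (Set.univ.pi s)
        ≤ (∏ i, C i)⁻¹ * ((∏ i, C i) * ∏ i, ν i (s i)) := by gcongr
      _ = ∏ i, ν i (s i) := by rw [← mul_assoc, ENNReal.inv_mul_cancel hP0 hP, one_mul]
  rw [Measure.le_iff]
  intro s hs
  have h2 : (∏ i, C i)⁻¹ * Measure.pi μ s ≤ Measure.pi ν s := by
    have := key s
    rw [Measure.pi_def ν, toMeasure_apply _ _ hs]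
    exact this
  calc Measure.pi μ s = (∏ i, C i) * ((∏ i, C i)⁻¹ * Measure.pi μ s) := by
        rw [← mul_assoc, ENNReal.mul_inv_cancel hP0 hP, one_mul]
    _ ≤ (∏ i, C i) * Measure.pi ν s := by gcongr

/-- Translating by `c` multiplies the measure by at most `exp r`. -/
def TranslateLE {α : Type*} [Add α] [MeasurableSpace α] (μ : Measure α) (c : α) (r : ℝ) : Prop :=
  μ.map (· + c) ≤ ENNReal.ofReal (Real.exp r) • μ

theorem TranslateLE.mono {α : Type*} [Add α] [MeasurableSpace α] {μ : Measure α} {c : α}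
    {r r' : ℝ} (h : TranslateLE μ c r) (hr : r ≤ r') : TranslateLE μ c r' := by
  refine h.trans ?_
  rw [Measure.le_iff]
  intro s _
  simp only [Measure.smul_apply, smul_eq_mul]
  gcongr

theorem TranslateLE.pi {ι : Type*} [Fintype ι] {α : Type*} [Add α] [MeasurableSpace α]
    [MeasurableAdd α] {μ : Measure α} [SigmaFinite μ] {c : ι → α} {r : ι → ℝ}
    (hσ : ∀ i, SigmaFinite (μ.map (· + c i)))
    (h : ∀ i, TranslateLE μ (c i) (r i)) :
    TranslateLE (Measure.pi fun _ : ι => μ) c (∑ i, r i) := by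
  have h1 : (Measure.pi fun _ : ι => μ).map (· + c) =
      Measure.pi fun i => μ.map (· + c i) :=
    (Measure.pi_map_pi (μ := fun _ : ι => μ) (f := fun i (x : α) => x + c i)
      fun _ => (measurable_add_const _).aemeasurable).symm ▸ rfl
  unfold TranslateLE
  rw [h1, Real.exp_sum, ENNReal.ofReal_prod_of_nonneg fun i _ => (Real.exp_pos _).le]
  exact pi_le_of_le_smul _ _ _ (fun i => by simp [Real.exp_pos]) (fun i => ENNReal.ofReal_ne_top) h

instance sigmaFinite_laplace (b : ℝ) : SigmaFinite (laplace b) :=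
  SigmaFinite.withDensity_ofReal _

theorem sigmaFinite_map_add {α : Type*} [AddGroup α] [MeasurableSpace α] [MeasurableAdd α]
    (μ : Measure α) [SigmaFinite μ] (c : α) : SigmaFinite (μ.map (· + c)) :=
  (MeasurableEquiv.addRight c).sigmaFinite_map

/-- By the triangle inequality, the densities at `x` and `x + c` have ratio at most `exp (|c| / b)`.
-/
theorem laplace_translateLE {b : ℝ} (hb : 0 < b) (c : ℝ) :
    TranslateLE (laplace b) c (|c| / b) := by
  unfold TranslateLE
  rw [Measure.le_iff]
  intro s hs
  have hm : Measurable fun x : ℝ => ENNReal.ofReal (Real.exp (-|x| / b) / (2 * b)) := by fun_prop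
  rw [Measure.map_apply (measurable_add_const c) hs, Measure.smul_apply, smul_eq_mul, laplace,
    withDensity_apply _ hs, withDensity_apply _ (measurable_add_const c hs),
    ← lintegral_indicator hs, ← lintegral_indicator (measurable_add_const c hs),
    ← lintegral_const_mul _ (hm.indicator hs), ← lintegral_add_right_eq_self
      (fun a => ENNReal.ofReal (Real.exp (|c| / b)) * s.indicator _ a) c]
  refine lintegral_mono fun x => ?_
  by_cases hx : x + c ∈ s
  · rw [Set.indicator_of_mem (show x ∈ (· + c) ⁻¹' s from hx), Set.indicator_of_mem hx,
      ← ENNReal.ofReal_mul (Real.exp_pos _).le]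
    refine ENNReal.ofReal_le_ofReal ?_
    rw [mul_div_assoc', ← Real.exp_add, ← add_div]
    gcongr
    linarith [abs_add_le x c]
  · rw [Set.indicator_of_notMem (show x ∉ (· + c) ⁻¹' s from hx)]
    exact zero_le

instance sigmaFinite_laplaceVec (d : ℕ) (b : ℝ) : SigmaFinite (laplaceVec d b) :=
  (MeasurableEquiv.toLp 2 (Fin d → ℝ)).sigmaFinite_map

theorem sum_abs_le_sqrt_mul_norm {d : ℕ} (c : EuclideanSpace ℝ (Fin d)) :
    ∑ i, |c i| ≤ Real.sqrt d * ‖c‖ := by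
  rw [EuclideanSpace.norm_eq, ← Real.sqrt_mul (Nat.cast_nonneg d)]
  refine Real.le_sqrt_of_sq_le ?_
  have := sq_sum_le_card_mul_sum_sq (s := (Finset.univ : Finset (Fin d))) (f := fun i => |c i|)
  simpa using this

/-- Independent coordinates pay for the `ℓ¹` norm of `c`; the factor `√d` in the scale converts it
to the Euclidean norm by Cauchy–Schwarz. -/
theorem laplaceVec_translateLE {d : ℕ} {b : ℝ} (hb : 0 < b) (c : EuclideanSpace ℝ (Fin d)) :
    TranslateLE (laplaceVec d (Real.sqrt d * b)) c (‖c‖ / b) := by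
  have h : TranslateLE (Measure.pi fun _ : Fin d => laplace (Real.sqrt d * b)) (fun i => c i)
      (‖c‖ / b) := by
    refine (TranslateLE.pi (fun i => sigmaFinite_map_add _ _)
      (fun i => laplace_translateLE (b := Real.sqrt d * b) ?_ (c i))).mono ?_
    · have : 0 < (d : ℝ) := by exact_mod_cast i.pos
      positivity
    · rw [← Finset.sum_div]
      rcases Nat.eq_zero_or_pos d with rfl | hd
      · simp; positivity
      · have hd' : 0 < Real.sqrt d := Real.sqrt_pos.2 (by exact_mod_cast hd)
        rw [div_le_div_iff₀ (by positivity) hb]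
        nlinarith [sum_abs_le_sqrt_mul_norm c]
  unfold TranslateLE at h ⊢
  have e : (laplaceVec d (Real.sqrt d * b)).map (· + c) =
      ((Measure.pi fun _ : Fin d => laplace (Real.sqrt d * b)).map (· + fun i => c i)).map
        (MeasurableEquiv.toLp 2 (Fin d → ℝ)) := by
    rw [laplaceVec, Measure.map_map (measurable_add_const c) (MeasurableEquiv.measurable _),
      Measure.map_map (MeasurableEquiv.measurable _) (measurable_add_const _)]
    rfl
  rw [e]
  refine (Measure.map_mono h (MeasurableEquiv.measurable _)).trans ?_
  rw [Measure.map_smul]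
  exact le_rfl

/-- Fubini: with the first coordinate frozen, the second translation is by a constant and costs `r₂`
uniformly; the first then costs `r₁`. Passing to a measurable hull of `S` spares any proof that the
messages are measurable in the noise. -/
theorem prod_shear_le {α β : Type*} [MeasurableSpace α] [MeasurableSpace β] [Add α] [Add β]
    [MeasurableAdd α] [MeasurableAdd₂ β]
    {μ : Measure α} {ν : Measure β} [SFinite μ] [SFinite ν] {c : α} {δ : α → β}
    (hδ : Measurable δ) {r₁ r₂ : ℝ} (hμ : TranslateLE μ c r₁)
    (hν : ∀ x, TranslateLE ν (δ x) r₂) (S : Set (α × β)) :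
    (μ.prod ν) {z | (z.1 + c, z.2 + δ z.1) ∈ S} ≤
      ENNReal.ofReal (Real.exp (r₁ + r₂)) * (μ.prod ν) S := by
  have hΦ : Measurable fun z : α × β => (z.1 + c, z.2 + δ z.1) :=
    (measurable_fst.add_const c).prodMk (measurable_snd.add (hδ.comp measurable_fst))
  set S' := toMeasurable (μ.prod ν) S
  have hS' : MeasurableSet S' := measurableSet_toMeasurable _ _
  have hslice : Measurable fun x => ν (Prod.mk x ⁻¹' S') := measurable_measure_prodMk_left hS'
  calc (μ.prod ν) {z | (z.1 + c, z.2 + δ z.1) ∈ S}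
      ≤ (μ.prod ν) {z | (z.1 + c, z.2 + δ z.1) ∈ S'} :=
        measure_mono fun z hz => subset_toMeasurable _ _ hz
    _ = ∫⁻ x, ν {y | (x + c, y + δ x) ∈ S'} ∂μ := Measure.prod_apply (hΦ hS')
    _ ≤ ∫⁻ x, ENNReal.ofReal (Real.exp r₂) * ν (Prod.mk (x + c) ⁻¹' S') ∂μ := by
        refine lintegral_mono fun x => ?_
        have := hν x (Prod.mk (x + c) ⁻¹' S')
        rwa [Measure.map_apply (measurable_add_const _) (measurable_prodMk_left hS')] at this
    _ = ENNReal.ofReal (Real.exp r₂) * ∫⁻ x, ν (Prod.mk x ⁻¹' S') ∂(μ.map (· + c)) := by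
        rw [lintegral_map hslice (measurable_add_const c),
          ← lintegral_const_mul' _ _ ENNReal.ofReal_ne_top]
    _ ≤ ENNReal.ofReal (Real.exp r₂) * (ENNReal.ofReal (Real.exp r₁) *
          ∫⁻ x, ν (Prod.mk x ⁻¹' S') ∂μ) := by
        gcongr
        rw [← smul_eq_mul, ← lintegral_smul_measure]
        exact lintegral_mono' hμ le_rfl
    _ = ENNReal.ofReal (Real.exp (r₁ + r₂)) * (μ.prod ν) S := by
        rw [← Measure.prod_apply hS', measure_toMeasurable, ← mul_assoc,
          ← ENNReal.ofReal_mul (Real.exp_pos _).le, ← Real.exp_add, add_comm r₂]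

/-! ### Changing one summand of a tree-based aggregation -/

/-- The nodes that contain the leaf `m` and take part in the release of some prefix of length at
most `T`. -/
def touched (T m : ℕ) : Finset (Node T) :=
  Finset.univ.filter fun v => (v.2 : ℕ) = m / 2 ^ (v.1 : ℕ) ∧ (v.2 : ℕ) % 2 = 0 ∧
    ((v.2 : ℕ) + 1) * 2 ^ (v.1 : ℕ) ≤ T

theorem mem_Ico_node_iff (b h m : ℕ) :
    m ∈ Finset.Ico (b * 2 ^ h) ((b + 1) * 2 ^ h) ↔ b = m / 2 ^ h := by
  have hp : 0 < 2 ^ h := by positivity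
  rw [Finset.mem_Ico, ← Nat.le_div_iff_mul_le hp, ← Nat.div_lt_iff_lt_mul hp]
  omega

theorem end_le_of_mem_prefixNodes {T n : ℕ} {v : Node T} (hv : v ∈ prefixNodes T n) :
    ((v.2 : ℕ) + 1) * 2 ^ (v.1 : ℕ) ≤ n := by
  simp only [prefixNodes, Finset.mem_filter, Finset.mem_univ, true_and] at hv
  rw [hv.2]
  exact Nat.div_mul_le_self _ _

/-- A node of height `h` enters the partition for `n` when `n / 2 ^ h` is odd, so its own index is
even. As `touched` does not mention `n`, a single translation serves all releases at once. -/
theorem mem_touched_iff_of_mem_prefixNodes {T n m : ℕ} (hn : n ≤ T) {v : Node T}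
    (hv : v ∈ prefixNodes T n) :
    v ∈ touched T m ↔
      m ∈ Finset.Ico ((v.2 : ℕ) * 2 ^ (v.1 : ℕ)) (((v.2 : ℕ) + 1) * 2 ^ (v.1 : ℕ)) := by
  have h1 := end_le_of_mem_prefixNodes hv
  simp only [prefixNodes, Finset.mem_filter, Finset.mem_univ, true_and] at hv
  have h2 : (v.2 : ℕ) % 2 = 0 := by
    have := hv.1
    rw [Nat.testBit_eq_decide_div_mod_eq, decide_eq_true_eq] at this
    omega
  rw [mem_Ico_node_iff]
  simp only [touched, Finset.mem_filter, Finset.mem_univ, true_and, h2, h1.trans hn, and_true]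

/-- The lists `l` and `l'` have the same length, and agree except that the entry of `l` at `m` (if
any) exceeds that of `l'` by `Δ`. -/
def DiffersAt {α : Type*} [AddCommMonoid α] (m : ℕ) (Δ : α) (l l' : List α) : Prop :=
  l.length = l'.length ∧ ∀ n < l.length, l.getD n 0 = l'.getD n 0 + if n = m then Δ else 0

theorem DiffersAt.append {α : Type*} [AddCommMonoid α] {m : ℕ} {Δ : α} {l l' : List α}
    (h : DiffersAt m Δ l l') {x x' : α} (hx : x = x' + if l.length = m then Δ else 0) :
    DiffersAt m Δ (l ++ [x]) (l' ++ [x']) := by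
  refine ⟨by simp [h.1], fun n hn => ?_⟩
  rw [List.length_append, List.length_singleton, Nat.lt_succ_iff_lt_or_eq] at hn
  rcases hn with hn | rfl
  · rw [List.getD_append _ _ _ _ hn, List.getD_append _ _ _ _ (h.1 ▸ hn)]
    exact h.2 n hn
  · rw [List.getD_append_right _ _ _ _ le_rfl, List.getD_append_right _ _ _ _ h.1.ge]
    simpa [h.1] using hx

/-- The translation of the noise of a tree that compensates for a change by `Δ` of the summand
`m`. -/
def treeShift (T m : ℕ) {α : Type*} [Zero α] (Δ : α) : TreeIdx T → α
  | Sum.inl v => if v ∈ touched T m then Δ else 0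
  | Sum.inr _ => 0

theorem DiffersAt.treeAgg_eq {T m : ℕ} {α : Type*} [AddCommMonoid α] {Δ : α} {l l' : List α}
    (h : DiffersAt m Δ l l') (hl : l.length ≤ T) (z : TreeIdx T → α) :
    treeAgg z l = treeAgg (fun v => z v + treeShift T m Δ v) l' := by
  unfold treeAgg
  rw [← h.1]
  congr 1
  · refine Finset.sum_congr rfl fun v hv => ?_
    have hs : nodeSum l v = nodeSum l' v + if v ∈ touched T m then Δ else 0 := by
      unfold nodeSum
      rw [if_congr (mem_touched_iff_of_mem_prefixNodes hl hv) rfl rfl,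
        ← Finset.sum_ite_eq' _ m fun _ => Δ,
        ← Finset.sum_add_distrib]
      refine Finset.sum_congr rfl fun n hn => h.2 n ?_
      -- All leaves below a node of the partition are filled, so the default value of `getD` never
      -- enters.
      exact (Finset.mem_Ico.1 hn).2.trans_le (end_le_of_mem_prefixNodes hv)
    rw [hs]
    simp only [treeShift]
    abel
  · simp [treeShift]

/-- Each height contributes at most one node, the ancestor of `m` at that height. -/
theorem touched_card_le_card {T m : ℕ} {s : Finset ℕ}
    (hs : ∀ v ∈ touched T m, (v.1 : ℕ) ∈ s) : (touched T m).card ≤ s.card := by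
  refine Finset.card_le_card_of_injOn (fun v => (v.1 : ℕ)) hs ?_
  rintro ⟨h, b⟩ hv ⟨h', b'⟩ hv' e
  obtain rfl : h = h' := Fin.ext e
  simp only [touched, Finset.coe_filter, Finset.mem_univ, true_and, Set.mem_ofPred_eq] at hv hv'
  obtain rfl : b = b' := Fin.ext (hv.1.trans hv'.1.symm)
  rfl

theorem height_le_log_of_mem_touched {T m : ℕ} {v : Node T} (hv : v ∈ touched T m) :
    (v.1 : ℕ) ≤ Nat.log 2 T := by
  simp only [touched, Finset.mem_filter, Finset.mem_univ, true_and] at hv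
  have h1 : 2 ^ (v.1 : ℕ) ≤ T := (Nat.le_mul_of_pos_left _ (Nat.succ_pos _)).trans hv.2.2
  exact Nat.le_log_of_pow_le one_lt_two h1

theorem card_touched_le (T m : ℕ) : (touched T m).card ≤ Nat.log 2 T + 1 := by
  refine (touched_card_le_card (s := Finset.range (Nat.log 2 T + 1)) fun v hv => ?_).trans
    (Finset.card_range _).le
  exact Finset.mem_range.2 (Nat.lt_succ_of_le (height_le_log_of_mem_touched hv))

/-- At the height of a binary digit `1` of `m`, the ancestor of `m` has odd index and is never used;
this saves one level. -/
theorem card_touched_le_of_pos {T m : ℕ} (hm : m ≠ 0) (hmT : m < T) :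
    (touched T m).card ≤ Nat.log 2 T := by
  obtain ⟨h₀, hh⟩ := Nat.exists_testBit_of_ne_zero hm
  have hh₀ : h₀ ∈ Finset.range (Nat.log 2 T + 1) := Finset.mem_range.2 <| Nat.lt_succ_of_le <|
    Nat.le_log_of_pow_le one_lt_two ((Nat.ge_two_pow_of_testBit hh).trans hmT.le)
  refine (touched_card_le_card (s := (Finset.range (Nat.log 2 T + 1)).erase h₀)
    fun v hv => Finset.mem_erase.2 ⟨?_, ?_⟩).trans ?_
  · rintro e
    simp only [touched, Finset.mem_filter, Finset.mem_univ, true_and] at hv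
    rw [Nat.testBit_eq_decide_div_mod_eq, decide_eq_true_eq, ← e, ← hv.1] at hh
    omega
  · exact Finset.mem_range.2 (Nat.lt_succ_of_le (height_le_log_of_mem_touched hv))
  · rw [Finset.card_erase_of_mem hh₀, Finset.card_range, Nat.add_sub_cancel]

theorem sum_treeShift (T m : ℕ) {α : Type*} [SeminormedAddCommGroup α] (Δ : α) :
    ∑ v, ‖treeShift T m Δ v‖ = (touched T m).card * ‖Δ‖ := by
  simp [Fintype.sum_sum_type, treeShift, apply_ite norm]

/-! ### The minimizer of the objective -/

section Argmin

variable {ι : Type*} [Fintype ι] {d : ℕ}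

theorem norm_midpoint_sq {E : Type*} [NormedAddCommGroup E] [InnerProductSpace ℝ E] (x y : E) :
    ‖(2⁻¹ : ℝ) • (x + y)‖ ^ 2 = (‖x‖ ^ 2 + ‖y‖ ^ 2) / 2 - ‖x - y‖ ^ 2 / 4 := by
  have := parallelogram_law_with_norm ℝ x y
  rw [norm_smul, mul_pow, Real.norm_of_nonneg (by norm_num : (0 : ℝ) ≤ 2⁻¹)]
  nlinarith

theorem midpoint_mem_feasible {ξ : ℝ} {X Y : ι → EuclideanSpace ℝ (Fin d)}
    (hX : X ∈ feasible ι d ξ) (hY : Y ∈ feasible ι d ξ) :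
    (2⁻¹ : ℝ) • (X + Y) ∈ feasible ι d ξ := by
  refine ⟨fun i => ?_, ?_⟩
  · rw [Pi.smul_apply, Pi.add_apply, norm_smul, Real.norm_of_nonneg (by norm_num)]
    linarith [norm_add_le (X i) (Y i), hX.1 i, hY.1 i]
  -- On an empty clique the factor `(N - 1)⁻¹` would be negative; for `N = 1` it is `0⁻¹ = 0`, which
  -- is harmless.
  · rcases isEmpty_or_nonempty ι with hι | hι
    · simpa [rowVariance] using hX.2
    have hN : (0 : ℝ) ≤ ((Fintype.card ι : ℝ) - 1)⁻¹ := by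
      have : (1 : ℝ) ≤ Fintype.card ι := by exact_mod_cast Fintype.card_pos
      exact inv_nonneg.2 (by linarith)
    have h : rowVariance ((2⁻¹ : ℝ) • (X + Y)) ≤ (rowVariance X + rowVariance Y) / 2 := by
      unfold rowVariance
      rw [← mul_add, mul_div_assoc, ← Finset.sum_add_distrib, Finset.sum_div]
      refine mul_le_mul_of_nonneg_left (Finset.sum_le_sum fun i _ => ?_) hN
      have e : ((2⁻¹ : ℝ) • (X + Y)) i - (Fintype.card ι : ℝ)⁻¹ • ∑ k, ((2⁻¹ : ℝ) • (X + Y)) k =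
          (2⁻¹ : ℝ) • ((X i - (Fintype.card ι : ℝ)⁻¹ • ∑ k, X k) +
            (Y i - (Fintype.card ι : ℝ)⁻¹ • ∑ k, Y k)) := by
        simp only [Pi.smul_apply, Pi.add_apply, ← Finset.smul_sum, Finset.sum_add_distrib]
        module
      rw [e, norm_midpoint_sq]
      have := sq_nonneg ‖(X i - (Fintype.card ι : ℝ)⁻¹ • ∑ k, X k) -
        (Y i - (Fintype.card ι : ℝ)⁻¹ • ∑ k, Y k)‖
      linarith
    linarith [hX.2, hY.2]

theorem isCompact_feasible (ξ : ℝ) : IsCompact (feasible ι d ξ) := by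
  have h : feasible ι d ξ = (Set.univ.pi fun _ => Metric.closedBall 0 1) ∩
      {X | rowVariance X ≤ ξ} := by
    ext X
    simp [feasible]
  rw [h]
  refine (isCompact_univ_pi fun _ => isCompact_closedBall _ _).inter_right
    (isClosed_le ?_ continuous_const)
  unfold rowVariance
  fun_prop

theorem zero_mem_feasible {ξ : ℝ} (hξ : 0 ≤ ξ) :
    (0 : ι → EuclideanSpace ℝ (Fin d)) ∈ feasible ι d ξ :=
  ⟨fun i => by simp, by simpa [rowVariance] using hξ⟩

theorem expertLevel_nonneg (k : Fin (Fintype.card ι)) : 0 ≤ expertLevel ι k := by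
  unfold expertLevel
  positivity

variable [DecidableEq ι]

theorem mahalanobisSq_eq (X : ι → EuclideanSpace ℝ (Fin d)) :
    mahalanobisSq X = (1 + (Fintype.card ι : ℝ)) * ∑ i, ‖X i‖ ^ 2 - ‖∑ i, X i‖ ^ 2 := by
  have h : ‖∑ i, X i‖ ^ 2 = ∑ i, ∑ k, inner ℝ (X i) (X k) := by
    rw [← real_inner_self_eq_norm_sq, sum_inner]
    simp_rw [inner_sum]
  rw [h, Finset.mul_sum, ← Finset.sum_sub_distrib]
  refine Finset.sum_congr rfl fun i _ => ?_
  simp [cliqueMatrix, Matrix.one_apply, sub_mul, Finset.sum_sub_distrib]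

/-- `A - I = N I - 1 1ᵀ` is positive semidefinite by Cauchy–Schwarz. This makes the objective
strongly convex. -/
theorem sum_sq_le_mahalanobisSq (X : ι → EuclideanSpace ℝ (Fin d)) :
    ∑ i, ‖X i‖ ^ 2 ≤ mahalanobisSq X := by
  rw [mahalanobisSq_eq]
  have h1 : ‖∑ i, X i‖ ^ 2 ≤ (∑ i, ‖X i‖) ^ 2 := by
    gcongr
    exact norm_sum_le _ _
  have h2 := sq_sum_le_card_mul_sum_sq (s := (Finset.univ : Finset ι)) (f := fun i => ‖X i‖)
  rw [Finset.card_univ] at h2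
  linarith

theorem ftrlObjective_midpoint (η : ℝ) (Γ X Y : ι → EuclideanSpace ℝ (Fin d)) :
    ftrlObjective η Γ ((2⁻¹ : ℝ) • (X + Y)) =
      (ftrlObjective η Γ X + ftrlObjective η Γ Y) / 2 - mahalanobisSq (X - Y) / 8 := by
  have h1 : ∑ i, ((2⁻¹ : ℝ) • (X + Y)) i = (2⁻¹ : ℝ) • (∑ i, X i + ∑ i, Y i) := by
    simp [← Finset.sum_add_distrib, Finset.smul_sum]
  have h2 : ∑ i, ‖((2⁻¹ : ℝ) • (X + Y)) i‖ ^ 2 =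
      (∑ i, ‖X i‖ ^ 2 + ∑ i, ‖Y i‖ ^ 2) / 2 - (∑ i, ‖X i - Y i‖ ^ 2) / 4 := by
    simp only [Pi.smul_apply, Pi.add_apply, norm_midpoint_sq]
    rw [Finset.sum_sub_distrib, ← Finset.sum_div, ← Finset.sum_div, Finset.sum_add_distrib]
  have h3 : ∑ i, inner ℝ (Γ i) (((2⁻¹ : ℝ) • (X + Y)) i) =
      (∑ i, inner ℝ (Γ i) (X i) + ∑ i, inner ℝ (Γ i) (Y i)) / 2 := by
    simp only [Pi.smul_apply, Pi.add_apply, inner_smul_right, inner_add_right]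
    rw [← Finset.mul_sum, Finset.sum_add_distrib]
    ring
  have h4 : ∑ i, (X i - Y i) = ∑ i, X i - ∑ i, Y i := by simp
  simp only [ftrlObjective, mahalanobisSq_eq, Pi.sub_apply, h1, h2, h3, h4, norm_midpoint_sq]
  ring

theorem ftrlArgmin_spec (η : ℝ) {ξ : ℝ} (hξ : 0 ≤ ξ) (Γ : ι → EuclideanSpace ℝ (Fin d)) :
    ftrlArgmin η ξ Γ ∈ feasible ι d ξ ∧
      IsMinOn (ftrlObjective η Γ) (feasible ι d ξ) (ftrlArgmin η ξ Γ) := by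
  refine Classical.epsilon_spec ((isCompact_feasible ξ).exists_isMinOn ⟨0, zero_mem_feasible hξ⟩ ?_)
  unfold ftrlObjective mahalanobisSq
  fun_prop

/-- Quadratic growth at the minimizer, obtained by testing minimality against the midpoint of `X`
and `Y`. -/
theorem mahalanobisSq_le_of_isMinOn {η ξ : ℝ} {Γ X Y : ι → EuclideanSpace ℝ (Fin d)}
    (hX : X ∈ feasible ι d ξ) (hmin : IsMinOn (ftrlObjective η Γ) (feasible ι d ξ) X)
    (hY : Y ∈ feasible ι d ξ) :
    mahalanobisSq (X - Y) / 4 ≤ ftrlObjective η Γ Y - ftrlObjective η Γ X := by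
  have := hmin (midpoint_mem_feasible hX hY)
  simp only [Set.mem_ofPred_eq, ftrlObjective_midpoint] at this
  linarith

/-- Adding the growth inequalities of the two minimizers cancels the quadratic terms and leaves `η
⟨Γ - Γ', Y - X⟩`, where rows of `Y - X` have norm at most `2`. The resulting Hölder bound is enough
for continuity. -/
theorem sum_sq_sub_ftrlArgmin_le (η : ℝ) {ξ : ℝ} (hξ : 0 ≤ ξ)
    (Γ Γ' : ι → EuclideanSpace ℝ (Fin d)) :
    ∑ i, ‖ftrlArgmin η ξ Γ i - ftrlArgmin η ξ Γ' i‖ ^ 2 ≤ 4 * |η| * ∑ i, ‖Γ i - Γ' i‖ := by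
  obtain ⟨hX, hXm⟩ := ftrlArgmin_spec η hξ Γ
  obtain ⟨hY, hYm⟩ := ftrlArgmin_spec η hξ Γ'
  set X := ftrlArgmin η ξ Γ
  set Y := ftrlArgmin η ξ Γ'
  have h1 := mahalanobisSq_le_of_isMinOn hX hXm hY
  have h2 := mahalanobisSq_le_of_isMinOn hY hYm hX
  have h3 := sum_sq_le_mahalanobisSq (X - Y)
  have h4 := sum_sq_le_mahalanobisSq (Y - X)
  simp only [Pi.sub_apply] at h3 h4
  simp_rw [fun i => norm_sub_rev (Y i) (X i)] at h4
  have h5 : η * ∑ i, inner ℝ (Γ i - Γ' i) (Y i - X i) ≤ |η| * ∑ i, 2 * ‖Γ i - Γ' i‖ := by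
    refine (le_abs_self _).trans ?_
    rw [abs_mul]
    gcongr
    refine (Finset.abs_sum_le_sum_abs _ _).trans (Finset.sum_le_sum fun i _ => ?_)
    refine (abs_real_inner_le_norm _ _).trans ?_
    rw [mul_comm]
    gcongr
    linarith [norm_sub_le (Y i) (X i), hX.1 i, hY.1 i]
  simp only [inner_sub_left, inner_sub_right, Finset.sum_sub_distrib, ← Finset.mul_sum] at h5
  simp only [ftrlObjective] at h1 h2
  linarith

theorem continuous_ftrlArgmin (η : ℝ) {ξ : ℝ} (hξ : 0 ≤ ξ) :
    Continuous (ftrlArgmin η ξ : (ι → EuclideanSpace ℝ (Fin d)) → _) := by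
  rw [continuous_iff_continuousAt]
  refine fun Γ => tendsto_pi_nhds.2 fun i => ?_
  rw [tendsto_iff_norm_sub_tendsto_zero]
  have h : Filter.Tendsto (fun Γ' : ι → EuclideanSpace ℝ (Fin d) =>
      Real.sqrt (4 * |η| * ∑ i, ‖Γ' i - Γ i‖)) (nhds Γ) (nhds 0) := by
    have : Continuous fun Γ' : ι → EuclideanSpace ℝ (Fin d) =>
      Real.sqrt (4 * |η| * ∑ i, ‖Γ' i - Γ i‖) := by fun_prop
    simpa using this.tendsto Γ
  refine squeeze_zero (fun _ => norm_nonneg _) (fun Γ' => Real.le_sqrt_of_sq_le ?_) h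
  exact (Finset.single_le_sum (f := fun i => ‖ftrlArgmin η ξ Γ' i - ftrlArgmin η ξ Γ i‖ ^ 2)
    (fun _ _ => sq_nonneg _) (Finset.mem_univ i)).trans (sum_sq_sub_ftrlArgmin_le η hξ Γ' Γ)

theorem ftrlArgmin_zero (η : ℝ) {ξ : ℝ} (hξ : 0 ≤ ξ) :
    ftrlArgmin η ξ (0 : ι → EuclideanSpace ℝ (Fin d)) = 0 := by
  obtain ⟨hX, hXm⟩ := ftrlArgmin_spec η hξ (0 : ι → EuclideanSpace ℝ (Fin d))
  have h1 := hXm (zero_mem_feasible hξ)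
  have h2 := sum_sq_le_mahalanobisSq (ftrlArgmin η ξ (0 : ι → EuclideanSpace ℝ (Fin d)))
  simp only [ftrlObjective, mahalanobisSq, Set.mem_ofPred_eq, Pi.zero_apply, inner_zero_left,
    Finset.sum_const_zero, mul_zero, zero_add, zero_div] at h1 h2
  have h3 := (Finset.sum_eq_zero_iff_of_nonneg fun i _ => sq_nonneg _).1
    (le_antisymm (h2.trans (by linarith)) (Finset.sum_nonneg fun i _ => sq_nonneg _))
  exact funext fun i => by simpa using h3 i (Finset.mem_univ i)

theorem CliqueState.norm_expert_le (β : ℕ → ℝ) (S : CliqueState ι d) (k : Fin (Fintype.card ι))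
    (i : ι) : ‖S.expert β k i‖ ≤ 1 :=
  (ftrlArgmin_spec _ (expertLevel_nonneg k) _).1.1 i

theorem CliqueState.expert_eq_zero (β : ℕ → ℝ) {S : CliqueState ι d} (hS : S.Γ = 0)
    (k : Fin (Fintype.card ι)) : S.expert β k = 0 := by
  rw [CliqueState.expert, hS, ftrlArgmin_zero _ (expertLevel_nonneg k)]

end Argmin

/-! ### Gradients of linear losses -/

theorem gradient_eq_of_mem_linearLosses {d : ℕ} {ℓ : EuclideanSpace ℝ (Fin d) → ℝ}
    (hℓ : ℓ ∈ linearLosses d) (x : EuclideanSpace ℝ (Fin d)) : gradient ℓ x = gradient ℓ 0 := by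
  have h : ℓ = (LinearMap.toContinuousLinearMap (hℓ.1.mk' ℓ) : EuclideanSpace ℝ (Fin d) →L[ℝ] ℝ) :=
    rfl
  unfold gradient
  rw [h, ContinuousLinearMap.fderiv, ContinuousLinearMap.fderiv]

theorem norm_gradient_le_of_mem_linearLosses {d : ℕ} {ℓ : EuclideanSpace ℝ (Fin d) → ℝ}
    (hℓ : ℓ ∈ linearLosses d) (x : EuclideanSpace ℝ (Fin d)) : ‖gradient ℓ x‖ ≤ 1 := by
  unfold gradient
  rw [LinearIsometryEquiv.norm_map]
  exact_mod_cast norm_fderiv_le_of_lipschitz ℝ hℓ.2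

/-! ### Rounds in which an agent is active -/

section Visits

variable {V : Type*} [DecidableEq V] {T : ℕ} (acts : Fin T → V)

/-- The number of rounds before `t` in which agent `i` is active. -/
def visits (i : V) (t : ℕ) : ℕ :=
  (Finset.univ.filter fun r : Fin T => (r : ℕ) < t ∧ acts r = i).card

theorem visits_zero (i : V) : visits acts i 0 = 0 := by
  simp [visits]

theorem visits_succ (i : V) {t : ℕ} (ht : t < T) :
    visits acts i (t + 1) = visits acts i t + if i = acts ⟨t, ht⟩ then 1 else 0 := by
  unfold visits
  split_ifs with h
  · rw [← Finset.card_insert_of_notMem (a := (⟨t, ht⟩ : Fin T)) (by simp)]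
    congr 1
    ext r
    simp only [Finset.mem_filter, Finset.mem_univ, true_and, Finset.mem_insert, Fin.ext_iff]
    constructor
    · rintro ⟨h1, h2⟩
      rcases Nat.lt_succ_iff_lt_or_eq.1 h1 with h3 | h3
      · exact Or.inr ⟨h3, h2⟩
      · exact Or.inl h3
    · rintro (h1 | ⟨h1, h2⟩)
      · exact ⟨by omega, by rw [h]; exact congrArg acts (Fin.ext h1)⟩
      · exact ⟨by omega, h2⟩
  · rw [add_zero]
    congr 1
    ext r
    simp only [Finset.mem_filter, Finset.mem_univ, true_and]
    refine ⟨fun ⟨h1, h2⟩ => ⟨?_, h2⟩, fun ⟨h1, h2⟩ => ⟨by omega, h2⟩⟩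
    rcases Nat.lt_succ_iff_lt_or_eq.1 h1 with h3 | h3
    · exact h3
    · exact absurd (h2.symm.trans (congrArg acts (Fin.ext h3))) h

theorem visits_le (i : V) (t : ℕ) : visits acts i t ≤ T :=
  (Finset.card_filter_le _ _).trans (by simp)

theorem visits_lt_visits {i : V} {t t' : ℕ} (ht : t < T) (hi : i = acts ⟨t, ht⟩) (h : t < t') :
    visits acts i t < visits acts i t' := by
  refine (Nat.lt_succ_self _).trans_le ?_
  have h1 := visits_succ acts i ht
  rw [if_pos hi] at h1
  rw [Nat.succ_eq_add_one, ← h1]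
  refine Finset.card_le_card fun r => ?_
  simp only [Finset.mem_filter, Finset.mem_univ, true_and]
  exact fun hr => ⟨by omega, hr.2⟩

theorem visits_lt (s : Fin T) : visits acts (acts s) s < T :=
  (visits_lt_visits acts s.2 rfl (Nat.lt_succ_self _)).trans_le (visits_le acts _ _)

/-- The count of visits grows at each activation, so an agent and a leaf of its tree determine the
round. -/
theorem eq_of_visits_eq {s t : Fin T} (ha : acts t = acts s)
    (h : visits acts (acts t) t = visits acts (acts s) s) : t = s := by
  rcases lt_trichotomy (t : ℕ) s with h1 | h1 | h1
  · have := visits_lt_visits acts t.2 rfl h1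
    rw [h, ha] at this
    exact absurd this (lt_irrefl _)
  · exact Fin.ext h1
  · have := visits_lt_visits acts s.2 rfl h1
    rw [← h, ha] at this
    exact absurd this (lt_irrefl _)

variable {d : ℕ} (ℓ ℓ' : Fin T → EuclideanSpace ℝ (Fin d) → ℝ) (s : Fin T)

/-- The change of the gradient observed by agent `i` in round `s`. -/
noncomputable def gradChange (i : V) : EuclideanSpace ℝ (Fin d) :=
  if i = acts s then gradient (ℓ s) 0 - gradient (ℓ' s) 0 else 0

variable {ℓ ℓ'}

/-- The change is keyed to the leaf index instead of the round, as `DiffersAt.append` requires; a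
different agent reaching the same leaf index has zero `gradChange`. -/
theorem gradient_eq_add_gradChange (h : ∀ t, t ≠ s → ℓ t = ℓ' t) (t : Fin T) :
    gradient (ℓ t) 0 = gradient (ℓ' t) 0 +
      if visits acts (acts t) t = visits acts (acts s) s then gradChange acts ℓ ℓ' s (acts t)
      else 0 := by
  by_cases hts : t = s
  · subst hts
    simp [gradChange]
  · rw [h t hts]
    split_ifs with hv
    · have : acts t ≠ acts s := fun ha => hts (eq_of_visits_eq acts ha hv)
      simp [gradChange, this]
    · simp

end Visits

/-! ### The states of the algorithm on linear losses -/

section States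

variable {V : Type*} [Fintype V] [DecidableEq V] {G : SimpleGraph V} [DecidableRel G.Adj]
  {d T : ℕ} (w : V → V → ℝ) (β : V → ℕ → ℝ)

theorem State.step_grads (z : Noise G d T) (a : V) (ℓ : EuclideanSpace ℝ (Fin d) → ℝ)
    (S : State G d) (i : V) : (S.step w β z a ℓ).grads i =
      if i = a then S.grads i ++ [gradient ℓ (S.predict w β a)] else S.grads i := rfl

theorem State.step_inners (z : Noise G d T) (a : V) (ℓ : EuclideanSpace ℝ (Fin d) → ℝ)
    (S : State G d) (j : V) (i : Nb G j) (k : Fin (nbCard G j)) :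
    (S.step w β z a ℓ).inners j i k =
      if i.1 = a then S.inners j i k ++
        [w a j * inner ℝ ((S.mem j).expert (β j) k i) (gradient ℓ (S.predict w β a))]
      else S.inners j i k := rfl

theorem State.step_mem (z : Noise G d T) (a : V) (ℓ : EuclideanSpace ℝ (Fin d) → ℝ)
    (S : State G d) (j : V) : (S.step w β z a ℓ).mem j =
      if a = j ∨ G.Adj j a then
        { rounds := (S.mem j).rounds + 1
          Γ := fun i =>
            if i.1 = a then w a j • treeAgg (fun v => z.1 (a, v)) ((S.step w β z a ℓ).grads a)
            else (S.mem j).Γ i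
          s := fun i k =>
            if i.1 = a then treeAgg (fun v => z.2 (⟨j, i, k⟩, v)) ((S.step w β z a ℓ).inners j i k)
            else (S.mem j).s i k }
      else S.mem j := rfl

variable (acts : Fin T → V) (ℓ : Fin T → EuclideanSpace ℝ (Fin d) → ℝ)

theorem length_grads_stateAt (z : Noise G d T) (i : V) (t : ℕ) (ht : t ≤ T) :
    ((stateAt w β acts ℓ z t ht).grads i).length = visits acts i t := by
  induction t with
  | zero => simp [stateAt, initState, visits_zero]
  | succ t ih =>
    rw [stateAt, State.step_grads, visits_succ acts i ht, ← ih (Nat.le_of_succ_le ht)]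
    split_ifs <;> simp

theorem length_inners_stateAt (z : Noise G d T) (j : V) (i : Nb G j) (k : Fin (nbCard G j))
    (t : ℕ) (ht : t ≤ T) :
    ((stateAt w β acts ℓ z t ht).inners j i k).length = visits acts i t := by
  induction t with
  | zero => simp [stateAt, initState, visits_zero]
  | succ t ih =>
    rw [stateAt, State.step_inners, visits_succ acts i ht, ← ih (Nat.le_of_succ_le ht)]
    split_ifs <;> simp

theorem Γ_stateAt_eq_zero (z : Noise G d T) {j : V} (i : Nb G j) (t : ℕ) (ht : t ≤ T)
    (h : visits acts i t = 0) : ((stateAt w β acts ℓ z t ht).mem j).Γ i = 0 := by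
  induction t with
  | zero => rfl
  | succ t ih =>
    rw [visits_succ acts i ht, Nat.add_eq_zero_iff] at h
    have hi : i.1 ≠ acts ⟨t, ht⟩ := fun e => by simp [e] at h
    rw [stateAt, State.step_mem]
    split_ifs
    · simpa [hi] using ih (Nat.le_of_succ_le ht) h.1
    · exact ih (Nat.le_of_succ_le ht) h.1

theorem rounds_stateAt (z z' : Noise G d T) (j : V) (t : ℕ) (ht : t ≤ T) :
    ((stateAt w β acts ℓ z t ht).mem j).rounds = ((stateAt w β acts ℓ z' t ht).mem j).rounds := by
  induction t with
  | zero => rfl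
  | succ t ih =>
    rw [stateAt, stateAt, State.step_mem, State.step_mem]
    split_ifs
    · simpa using ih (Nat.le_of_succ_le ht)
    · exact ih (Nat.le_of_succ_le ht)

variable {ℓ}

theorem grads_stateAt (hℓ : ∀ t, ℓ t ∈ linearLosses d) (z z' : Noise G d T) (i : V) (t : ℕ)
    (ht : t ≤ T) : (stateAt w β acts ℓ z t ht).grads i = (stateAt w β acts ℓ z' t ht).grads i := by
  induction t with
  | zero => rfl
  | succ t ih =>
    rw [stateAt, stateAt, State.step_grads, State.step_grads, ih (Nat.le_of_succ_le ht),
      gradient_eq_of_mem_linearLosses (hℓ _),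
      gradient_eq_of_mem_linearLosses (hℓ _) (State.predict _ _ (stateAt w β acts ℓ z' _ _) _)]

theorem Γ_stateAt (hℓ : ∀ t, ℓ t ∈ linearLosses d) {z z' : Noise G d T} (hz : z.1 = z'.1) (j : V)
    (t : ℕ) (ht : t ≤ T) :
    ((stateAt w β acts ℓ z t ht).mem j).Γ = ((stateAt w β acts ℓ z' t ht).mem j).Γ := by
  induction t with
  | zero => rfl
  | succ t ih =>
    have hg := grads_stateAt w β acts hℓ z z' (acts ⟨t, ht⟩) (t + 1) ht
    rw [stateAt, stateAt] at hg
    rw [stateAt, stateAt, State.step_mem, State.step_mem, hg, hz]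
    split_ifs
    · simp [ih (Nat.le_of_succ_le ht)]
    · exact ih (Nat.le_of_succ_le ht)

/-- Inner-product noise affects the expert probabilities and hence the predictions, but linear
losses hide the predictions from the gradients. This is why `innerChange` may set that noise to
zero, and why the coupling is triangular. -/
theorem expert_stateAt (hℓ : ∀ t, ℓ t ∈ linearLosses d) {z z' : Noise G d T} (hz : z.1 = z'.1)
    (j : V) (t : ℕ) (ht : t ≤ T) :
    ((stateAt w β acts ℓ z t ht).mem j).expert (β j) =
      ((stateAt w β acts ℓ z' t ht).mem j).expert (β j) := by
  funext k
  rw [CliqueState.expert, CliqueState.expert, Γ_stateAt w β acts hℓ hz,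
    rounds_stateAt w β acts ℓ z z']

theorem continuous_Γ_stateAt (hℓ : ∀ t, ℓ t ∈ linearLosses d) (z₂ : InnerIdx G × TreeIdx T → ℝ)
    (j : V) (t : ℕ) (ht : t ≤ T) :
    Continuous fun z₁ => ((stateAt w β acts ℓ ((z₁, z₂) : Noise G d T) t ht).mem j).Γ := by
  induction t with
  | zero => exact continuous_const
  | succ t ih =>
    -- Comparison with zero noise shows that the gradient lists are constant in `z₁`, so only the
    -- tree noise varies in the new row.
    have hg := fun z₁ => grads_stateAt w β acts hℓ (z₁, z₂) 0 (acts ⟨t, ht⟩) (t + 1) ht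
    simp only [stateAt] at hg
    simp only [stateAt, State.step_mem, hg]
    split_ifs
    · refine continuous_pi fun i => ?_
      dsimp only
      split_ifs
      · unfold treeAgg
        fun_prop
      · exact (continuous_apply i).comp (ih (Nat.le_of_succ_le ht))
    · exact ih (Nat.le_of_succ_le ht)

theorem continuous_expert_stateAt (hℓ : ∀ t, ℓ t ∈ linearLosses d)
    (z₂ : InnerIdx G × TreeIdx T → ℝ) (j : V) (k : Fin (nbCard G j)) (t : ℕ) (ht : t ≤ T) :
    Continuous fun z₁ =>
      ((stateAt w β acts ℓ ((z₁, z₂) : Noise G d T) t ht).mem j).expert (β j) k := by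
  simp only [CliqueState.expert, fun z₁ => rounds_stateAt w β acts ℓ (z₁, z₂) 0 j t ht]
  exact (continuous_ftrlArgmin _ (expertLevel_nonneg k)).comp
    (continuous_Γ_stateAt w β acts hℓ z₂ j t ht)

/-! ### Coupling the executions on two sequences of losses -/

variable (ℓ) (ℓ' : Fin T → EuclideanSpace ℝ (Fin d) → ℝ) (s : Fin T)

/-- The change of the summands of the inner-product sums in round `s`, as a function of the noise
of the gradient sums. -/
noncomputable def innerChange (z₁ : V × TreeIdx T → EuclideanSpace ℝ (Fin d)) (p : InnerIdx G) : ℝ :=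
  w p.2.1 p.1 * inner ℝ
    (((stateAt w β acts ℓ ((z₁, 0) : Noise G d T) s s.2.le).mem p.1).expert (β p.1) p.2.2 p.2.1)
    (gradChange acts ℓ ℓ' s p.2.1)

/-- The translation of the noise of the gradient sums. -/
noncomputable def gradTranslation : V × TreeIdx T → EuclideanSpace ℝ (Fin d) := fun p =>
  treeShift T (visits acts (acts s) s) (gradChange acts ℓ ℓ' s p.1) p.2

/-- The translation of the noise of the inner-product sums. -/
noncomputable def innerTranslation (z₁ : V × TreeIdx T → EuclideanSpace ℝ (Fin d)) :
    InnerIdx G × TreeIdx T → ℝ := fun p =>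
  treeShift T (visits acts (acts s) s) (innerChange w β acts ℓ ℓ' s z₁ p.1) p.2

variable {ℓ ℓ'}

/-- The three invariants feed each other: equal memories give equal experts, so the summands change
only at leaf `m` and by the prescribed amount; the translated noise absorbs this, so the updated
memories are equal again. -/
theorem stateAt_coupling (hℓ : ∀ t, ℓ t ∈ linearLosses d) (hℓ' : ∀ t, ℓ' t ∈ linearLosses d)
    (h : ∀ t, t ≠ s → ℓ t = ℓ' t) (z z' : Noise G d T)
    (hz : z' = (z.1 + gradTranslation acts ℓ ℓ' s, z.2 + innerTranslation w β acts ℓ ℓ' s z.1))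
    (t : ℕ) (ht : t ≤ T) :
    (∀ j, (stateAt w β acts ℓ z t ht).mem j = (stateAt w β acts ℓ' z' t ht).mem j) ∧
    (∀ i, DiffersAt (visits acts (acts s) s) (gradChange acts ℓ ℓ' s i)
      ((stateAt w β acts ℓ z t ht).grads i) ((stateAt w β acts ℓ' z' t ht).grads i)) ∧
    (∀ j i k, DiffersAt (visits acts (acts s) s) (innerChange w β acts ℓ ℓ' s z.1 ⟨j, i, k⟩)
      ((stateAt w β acts ℓ z t ht).inners j i k)
      ((stateAt w β acts ℓ' z' t ht).inners j i k)) := by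
  induction t with
  | zero => exact ⟨fun _ => rfl, fun _ => ⟨rfl, by simp [stateAt, initState]⟩,
      fun _ _ _ => ⟨rfl, by simp [stateAt, initState]⟩⟩
  | succ t ih =>
    obtain ⟨hm, hg, hi⟩ := ih (Nat.le_of_succ_le ht)
    have hgrad := gradient_eq_add_gradChange acts s h ⟨t, ht⟩
    have hg' : ∀ i, DiffersAt (visits acts (acts s) s) (gradChange acts ℓ ℓ' s i)
        ((stateAt w β acts ℓ z (t + 1) ht).grads i)
        ((stateAt w β acts ℓ' z' (t + 1) ht).grads i) := by
      intro i
      rw [stateAt, stateAt, State.step_grads, State.step_grads]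
      split_ifs with hia
      · subst hia
        refine (hg _).append ?_
        rw [length_grads_stateAt, gradient_eq_of_mem_linearLosses (hℓ _),
          gradient_eq_of_mem_linearLosses (hℓ' _)]
        exact hgrad
      · exact hg i
    have hi' : ∀ j i k, DiffersAt (visits acts (acts s) s)
        (innerChange w β acts ℓ ℓ' s z.1 ⟨j, i, k⟩)
        ((stateAt w β acts ℓ z (t + 1) ht).inners j i k)
        ((stateAt w β acts ℓ' z' (t + 1) ht).inners j i k) := by
      intro j i k
      rw [stateAt, stateAt, State.step_inners, State.step_inners]
      split_ifs with hia
      · refine (hi j i k).append ?_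
        rw [length_inners_stateAt, gradient_eq_of_mem_linearLosses (hℓ _),
          gradient_eq_of_mem_linearLosses (hℓ' _), hgrad, hm, inner_add_right, mul_add, hia]
        congr 1
        split_ifs with hv
        · rw [innerChange, hia]
          -- Reaching leaf `m` forces `t = s` only if the same agent is active; otherwise the change
          -- is zero.
          by_cases hs : acts ⟨t, ht⟩ = acts s
          · obtain rfl := eq_of_visits_eq acts hs hv
            rw [← hm, expert_stateAt w β acts hℓ (z := z) (z' := (z.1, 0)) rfl]
          · simp [gradChange, hs]
        · simp
      · exact hi j i k
    refine ⟨fun j => ?_, hg', hi'⟩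
    have hgT : ∀ i, ((stateAt w β acts ℓ z (t + 1) ht).grads i).length ≤ T := fun i => by
      rw [length_grads_stateAt]
      exact visits_le acts _ _
    have hiT : ∀ i k, ((stateAt w β acts ℓ z (t + 1) ht).inners j i k).length ≤ T := fun i k => by
      rw [length_inners_stateAt]
      exact visits_le acts _ _
    have hgA := (hg' (acts ⟨t, ht⟩)).treeAgg_eq (hgT _) fun v => z.1 (acts ⟨t, ht⟩, v)
    have hiA := fun i k => (hi' j i k).treeAgg_eq (hiT i k) fun v => z.2 (⟨j, i, k⟩, v)
    rw [stateAt, stateAt] at hgA ⊢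
    simp only [stateAt] at hiA
    rw [State.step_mem, State.step_mem]
    subst hz
    split_ifs
    · rw [hgA, hm]
      simp only [hiA]
      rfl
    · exact hm j

theorem batch_coupling (hℓ : ∀ t, ℓ t ∈ linearLosses d) (hℓ' : ∀ t, ℓ' t ∈ linearLosses d)
    (h : ∀ t, t ≠ s → ℓ t = ℓ' t) (z : Noise G d T) (i : V) :
    batch w β acts ℓ z i = batch w β acts ℓ'
      (z.1 + gradTranslation acts ℓ ℓ' s, z.2 + innerTranslation w β acts ℓ ℓ' s z.1) i := by
  have hm := fun t ht => (stateAt_coupling w β acts s hℓ hℓ' h z _ rfl t ht).1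
  funext t j
  simp only [batch, hm]

/-- Required for Fubini along the shear; the experts are continuous in the gradient noise. -/
theorem measurable_innerTranslation (hℓ : ∀ t, ℓ t ∈ linearLosses d) :
    Measurable (innerTranslation (G := G) w β acts ℓ ℓ' s) := by
  refine measurable_pi_lambda _ ?_
  rintro ⟨p, v | v⟩
  · simp only [innerTranslation, treeShift]
    split_ifs
    · refine Continuous.measurable ?_
      unfold innerChange
      have := (continuous_apply p.2.1).comp
        (continuous_expert_stateAt w β acts hℓ (0 : InnerIdx G × TreeIdx T → ℝ) p.1 p.2.2 s s.2.le)
      exact continuous_const.mul (this.inner continuous_const)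
    · exact measurable_const
  · exact measurable_const

end States

/-! ### The privacy budget -/

section Budget

variable {V : Type*} [Fintype V] [DecidableEq V] {G : SimpleGraph V} [DecidableRel G.Adj]
  {d T : ℕ} {w : V → V → ℝ} (β : V → ℕ → ℝ) (acts : Fin T → V)
  {ℓ ℓ' : Fin T → EuclideanSpace ℝ (Fin d) → ℝ} (s : Fin T)

theorem sum_Nb_comm (f : V → V → ℝ) : ∑ j, ∑ i : Nb G j, f i j = ∑ i, ∑ j : Nb G i, f i j := by
  let e : ((j : V) × Nb G j) ≃ ((i : V) × Nb G i) :=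
    ⟨fun p => ⟨p.2, p.1, nb_symm G p.2.2⟩, fun p => ⟨p.2, p.1, nb_symm G p.2.2⟩,
      fun _ => rfl, fun _ => rfl⟩
  rw [← Fintype.sum_sigma' fun j (i : Nb G j) => f i j,
    ← Fintype.sum_sigma' fun i (j : Nb G i) => f i j]
  exact e.sum_comp fun p => f p.1 p.2

theorem nbCard_le_nMax (i : V) : nbCard G i ≤ nMax G :=
  Finset.le_sup (f := fun i => nbCard G i) (Finset.mem_univ i)

theorem nbCard_pos (i : V) : 0 < nbCard G i :=
  Fintype.card_pos_iff.2 ⟨⟨i, Or.inl rfl⟩⟩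

theorem sum_norm_gradChange_le (hℓ : ∀ t, ℓ t ∈ linearLosses d)
    (hℓ' : ∀ t, ℓ' t ∈ linearLosses d) : ∑ i, ‖gradChange acts ℓ ℓ' s i‖ ≤ 2 := by
  simp only [gradChange, apply_ite norm, norm_zero, Finset.sum_ite_eq', Finset.mem_univ, if_true]
  linarith [norm_sub_le (gradient (ℓ s) 0) (gradient (ℓ' s) 0),
    norm_gradient_le_of_mem_linearLosses (hℓ s) 0, norm_gradient_le_of_mem_linearLosses (hℓ' s) 0]

theorem abs_innerChange_le (hw : ∀ i, ∀ j : Nb G i, 0 ≤ w i j)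
    (z₁ : V × TreeIdx T → EuclideanSpace ℝ (Fin d)) (p : InnerIdx G) :
    |innerChange w β acts ℓ ℓ' s z₁ p| ≤ w p.2.1 p.1 * ‖gradChange acts ℓ ℓ' s p.2.1‖ := by
  have hw' : 0 ≤ w p.2.1 p.1 := hw p.2.1 ⟨p.1, nb_symm G p.2.1.2⟩
  rw [innerChange, abs_mul, abs_of_nonneg hw']
  refine mul_le_mul_of_nonneg_left ((abs_real_inner_le_norm _ _).trans ?_) hw'
  exact mul_le_of_le_one_left (norm_nonneg _) (CliqueState.norm_expert_le _ _ _ _)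

theorem sum_abs_innerChange_le (hw : ∀ i, ∀ j : Nb G i, 0 ≤ w i j)
    (hw_sum : ∀ i, ∑ j : Nb G i, w i j = 1) (hℓ : ∀ t, ℓ t ∈ linearLosses d)
    (hℓ' : ∀ t, ℓ' t ∈ linearLosses d) (z₁ : V × TreeIdx T → EuclideanSpace ℝ (Fin d)) :
    ∑ p, |innerChange (G := G) w β acts ℓ ℓ' s z₁ p| ≤ 2 * nMax G := by
  calc ∑ p, |innerChange (G := G) w β acts ℓ ℓ' s z₁ p|
      ≤ ∑ p : InnerIdx G, w p.2.1 p.1 * ‖gradChange acts ℓ ℓ' s p.2.1‖ :=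
        Finset.sum_le_sum fun p _ => abs_innerChange_le β acts s hw z₁ p
    _ = ∑ j, ∑ i : Nb G j, (nbCard G j : ℝ) * (w i j * ‖gradChange acts ℓ ℓ' s i‖) := by
        simp [Fintype.sum_sigma, Fintype.sum_prod_type]
    _ ≤ ∑ j, ∑ i : Nb G j, (nMax G : ℝ) * (w i j * ‖gradChange acts ℓ ℓ' s i‖) := by
        refine Finset.sum_le_sum fun j _ => Finset.sum_le_sum fun i _ => ?_
        have hw' : 0 ≤ w i j := hw i ⟨j, nb_symm G i.2⟩
        have := nbCard_le_nMax (G := G) j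
        gcongr
    _ = nMax G * ∑ i, ‖gradChange acts ℓ ℓ' s i‖ := by
        -- The weights are normalized over `j` for fixed `i`, so the order of summation must be
        -- exchanged before using `hw_sum`.
        rw [sum_Nb_comm fun i j => (nMax G : ℝ) * (w i j * ‖gradChange acts ℓ ℓ' s i‖),
          Finset.mul_sum]
        refine Finset.sum_congr rfl fun i _ => ?_
        rw [← Finset.mul_sum, ← Finset.sum_mul, hw_sum, one_mul]
    _ ≤ 2 * nMax G := by
        rw [mul_comm 2]
        exact mul_le_mul_of_nonneg_left (sum_norm_gradChange_le acts s hℓ hℓ') (Nat.cast_nonneg _)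

/-- Isolated agents that are active for the first time have a zero prediction. -/
theorem innerChange_eq_zero (hG : nMax G ≤ 1) (hs : visits acts (acts s) s = 0)
    (z₁ : V × TreeIdx T → EuclideanSpace ℝ (Fin d)) (p : InnerIdx G) :
    innerChange w β acts ℓ ℓ' s z₁ p = 0 := by
  obtain ⟨j, i, k⟩ := p
  unfold innerChange
  by_cases hi : i.1 = acts s
  · have hΓ : ((stateAt w β acts ℓ ((z₁, 0) : Noise G d T) s s.2.le).mem j).Γ = 0 := by
      funext i'
      have := Fintype.card_le_one_iff.1 ((nbCard_le_nMax j).trans hG) i' i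
      exact Γ_stateAt_eq_zero w β acts ℓ _ i' s _ (by rw [this, hi, hs])
    simp [CliqueState.expert_eq_zero _ hΓ]
  · simp [gradChange, hi]

theorem gradTranslation_translateLE (hℓ : ∀ t, ℓ t ∈ linearLosses d)
    (hℓ' : ∀ t, ℓ' t ∈ linearLosses d) {b : ℝ} (hb : 0 < b) :
    TranslateLE (MeasureTheory.Measure.pi fun _ : V × TreeIdx T => laplaceVec d (Real.sqrt d * b))
      (gradTranslation acts ℓ ℓ' s) ((touched T (visits acts (acts s) s)).card * 2 / b) := by
  refine (TranslateLE.pi (fun _ => sigmaFinite_map_add _ _)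
    fun p => laplaceVec_translateLE hb (gradTranslation acts ℓ ℓ' s p)).mono ?_
  rw [← Finset.sum_div]
  gcongr
  simp only [gradTranslation, Fintype.sum_prod_type, sum_treeShift, ← Finset.mul_sum]
  gcongr
  exact sum_norm_gradChange_le acts s hℓ hℓ'

theorem innerTranslation_translateLE (z₁ : V × TreeIdx T → EuclideanSpace ℝ (Fin d)) {R : ℝ}
    (hR : ∑ p, |innerChange (G := G) w β acts ℓ ℓ' s z₁ p| ≤ R) {b : ℝ} (hb : 0 < b) :
    TranslateLE (MeasureTheory.Measure.pi fun _ : InnerIdx G × TreeIdx T => laplace b)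
      (innerTranslation w β acts ℓ ℓ' s z₁)
      ((touched T (visits acts (acts s) s)).card * R / b) := by
  refine (TranslateLE.pi (fun _ => sigmaFinite_map_add _ _)
    fun p => laplace_translateLE hb (innerTranslation w β acts ℓ ℓ' s z₁ p)).mono ?_
  rw [← Finset.sum_div]
  gcongr
  simp only [innerTranslation, Fintype.sum_prod_type, ← Real.norm_eq_abs, sum_treeShift,
    ← Finset.mul_sum]
  gcongr
  exact hR

/-- Since `2 ^ ⌊log₂ T⌋ ≤ T`, this amounts to `log 2 ≥ 2/3`, the origin of the constant 6. -/
theorem four_mul_log_le {T : ℕ} (hT : 2 ≤ T) : 4 * (Nat.log 2 T : ℝ) ≤ 6 * Real.log T := by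
  have h1 : (2 : ℝ) ^ Nat.log 2 T ≤ T := by exact_mod_cast Nat.pow_log_le_self 2 (by omega)
  have h2 := Real.log_le_log (by positivity) h1
  rw [Real.log_pow] at h2
  have h3 := mul_le_mul_of_nonneg_left Real.log_two_gt_d9.le
    (Nat.cast_nonneg (α := ℝ) (Nat.log 2 T))
  linarith [Nat.cast_nonneg (α := ℝ) (Nat.log 2 T)]

/-- The total budget spent on the gradient sums and the inner-product sums. -/
theorem budget_le (hT : 2 ≤ T) (hw : ∀ i, ∀ j : Nb G i, 0 ≤ w i j)
    (hw_sum : ∀ i, ∑ j : Nb G i, w i j = 1) (hℓ : ∀ t, ℓ t ∈ linearLosses d)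
    (hℓ' : ∀ t, ℓ' t ∈ linearLosses d) :
    ∃ R : ℝ, (∀ z₁, ∑ p, |innerChange (G := G) w β acts ℓ ℓ' s z₁ p| ≤ R) ∧
      (touched T (visits acts (acts s) s)).card * (2 + R) ≤ 6 * (nMax G : ℝ) ^ 2 * Real.log T := by
  set m := visits acts (acts s) s with hm
  have hL : 1 ≤ Nat.log 2 T := Nat.log_pos one_lt_two hT
  have hN : 1 ≤ nMax G := (nbCard_pos (acts s)).trans_le (nbCard_le_nMax _)
  have hlog := four_mul_log_le hT
  have hC : ((touched T m).card : ℝ) ≤ 2 * Nat.log 2 T := by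
    have := card_touched_le T m
    exact_mod_cast (by omega : (touched T m).card ≤ 2 * Nat.log 2 T)
  have hL0 : (0 : ℝ) ≤ Nat.log 2 T := Nat.cast_nonneg _
  -- For `N_max ≥ 2`, the inequality `1 + N ≤ N²` leaves room for the crude count `C ≤ 2 ⌊log₂ T⌋`.
  -- For `N_max = 1` this would lose a factor 2, recovered from `R = 0` if `m = 0` and from `C ≤
  -- ⌊log₂ T⌋` otherwise.
  by_cases hN2 : 2 ≤ nMax G
  · refine ⟨_, sum_abs_innerChange_le β acts s hw hw_sum hℓ hℓ', ?_⟩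
    have hN2' : (2 : ℝ) ≤ nMax G := by exact_mod_cast hN2
    calc ((touched T m).card : ℝ) * (2 + 2 * nMax G)
        ≤ 2 * Nat.log 2 T * (2 + 2 * nMax G) := by gcongr
      _ = 4 * Nat.log 2 T * (1 + nMax G) := by ring
      _ ≤ 6 * Real.log T * (nMax G : ℝ) ^ 2 := by
          gcongr
          nlinarith
      _ = 6 * (nMax G : ℝ) ^ 2 * Real.log T := by ring
  · have hN1 : nMax G = 1 := by omega
    by_cases hm0 : m = 0
    · refine ⟨0, fun z₁ => ?_, ?_⟩
      · simp [innerChange_eq_zero β acts s hN1.le (hm ▸ hm0)]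
      · rw [hN1]
        push_cast
        linarith
    · refine ⟨_, sum_abs_innerChange_le β acts s hw hw_sum hℓ hℓ', ?_⟩
      have hC' : ((touched T m).card : ℝ) ≤ Nat.log 2 T := by
        exact_mod_cast card_touched_le_of_pos hm0 (visits_lt acts s)
      rw [hN1]
      push_cast
      linarith

end Budget

end MTPriv

theorem mainTheorem5 {V : Type*} [Fintype V] [DecidableEq V] (G : SimpleGraph V)
    [DecidableRel G.Adj] (d T : ℕ) (hT : 2 ≤ T)
    (w : V → V → ℝ) (hw_nonneg : ∀ i, ∀ j : MTPriv.Nb G i, 0 ≤ w i j)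
    (hw_sum : ∀ i, ∑ j : MTPriv.Nb G i, w i j = 1)
    (β : V → ℕ → ℝ) (hβ : ∀ j n, 0 < β j n)
    (ε ε' : ℝ) (hε : 0 < ε) (hε' : ε' = ε / (6 * (MTPriv.nMax G : ℝ) ^ 2)) :
    MTPriv.LossLevelDP
      (MTPriv.noiseLaw G T
        (MTPriv.laplaceVec d (Real.sqrt d * Real.log T / ε'))
        (MTPriv.laplace (Real.log T / ε')))
      (MTPriv.linearLosses d)
      (MTPriv.batch (G := G) w β) ε := by
  intro acts ℓ ℓ' hℓ hℓ' hdiff i M _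
  obtain ⟨s, hs⟩ : ∃ s, ∀ t, t ≠ s → ℓ t = ℓ' t := by
    by_cases h : ∃ s, ℓ s ≠ ℓ' s
    · obtain ⟨s, hs⟩ := h
      exact ⟨s, fun t hts => by_contra fun ht => hts (hdiff t s ht hs)⟩
    · push Not at h
      -- If the sequences coincide, any round can play the role of `s`.
      exact ⟨⟨0, by omega⟩, fun t _ => h t⟩
  have hlog : 0 < Real.log T := Real.log_pos (by exact_mod_cast hT)
  have hN : (0 : ℝ) < MTPriv.nMax G := by
    exact_mod_cast (MTPriv.nbCard_pos i).trans_le (MTPriv.nbCard_le_nMax _)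
  have hb : 0 < Real.log T / ε' := by
    rw [hε']
    positivity
  obtain ⟨R, hR, hbudget⟩ := MTPriv.budget_le β acts s hT hw_nonneg hw_sum hℓ hℓ'
  rw [mul_div_assoc]
  have key := MTPriv.prod_shear_le (MTPriv.measurable_innerTranslation w β acts s hℓ)
    (MTPriv.gradTranslation_translateLE acts s hℓ hℓ' hb)
    (fun z₁ => MTPriv.innerTranslation_translateLE β acts s z₁ (hR z₁) hb)
    {z | MTPriv.batch w β acts ℓ' z i ∈ M}
  simp only [MTPriv.batch_coupling w β acts s hℓ hℓ' hs]
  refine key.trans ?_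
  unfold MTPriv.noiseLaw
  gcongr
  -- With scale `b = log T / ε'`, the allowance `ε * b` equals `6 N_max² log T`, the bound in
  -- `hbudget`.
  rw [← add_div, ← mul_add, div_le_iff₀ hb, hε']
  refine hbudget.trans (le_of_eq ?_)
  field_simp
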